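/- Let $N$ clients have weights $\lambda_i\ge 0$, $\sum_{i=1}^N\lambda_i=1$, and let $K\in[1,N]$ be a real sampling budget. In round $t=1,2,\dots$ client $i$ has a (possibly random) local update $g_i^t\in\mathbb R^d$, and its feedback is $\pi_t(i)=\lambda_i\|g_i^t\|$. Assume that feedback converges at rate $O(1/\sqrt t)$: almost surely there are limits $\pi_*(i)$ and a finite $c$ with $|\pi_t(i)-\pi_*(i)|\le c/\sqrt t$ for all $i$ and $t\ge 1$. Fix a horizon $T$ with $TK\ge N$, let $G>0$ satisfy $\pi_t(i)\le G$ almost surely for all $i$ and $t\le T$, and put $$\theta=\Big(\frac{N}{TK}\Big)^{1/3},\qquad \gamma=\frac{G^2N}{K\theta}.$$ Let $\Delta=\{p\in\mathbb R^N: 0<p_i\le 1,\ \sum_{i=1}^N p_i=K\}$. The K‑Vib sampler works as follows. In round $t\le T$ it computes the FTRL solution $$p^t=\arg\min_{p\in\Delta}\ \sum_{i=1}^N\frac{\omega_{t-1}(i)+\gamma}{p_i},\qquad \omega_{t-1}(i)=\sum_{s<t}\frac{\pi_s(i)^2}{\tilde p_i^{\,s}}\,\mathbf 1[i\in S^s],$$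 forms the mixed distribution $\tilde p_i^{\,t}=(1-\theta)p_i^t+\theta K/N$, and draws $S^t$ by including each client $i$ independently with probability $\tilde p_i^{\,t}$, conditionally on $\mathcal F_t$. Here $(\mathcal F_t)$ is a filtration such that $g^t$ is $\mathcal F_t$-measurable and $S^t$ is $\mathcal F_{t+1}$-measurable; thus $g^t$ may depend on $S^1,\dots,S^{t-1}$. With $\ell_t(p)=\sum_{i=1}^N \pi_t(i)^2/p_i$, the static regret is $$\mathrm{Regret}_S(T)=\sum_{t=1}^T\ell_t(\tilde p^{\,t})-\inf_{p\in\Delta}\sum_{t=1}^T\ell_t(p).$$ **Theorem.** There are absolute constants $C>0$ and $k\in\mathbb N$ such that, in every such situation, $\mathrm{Regret}_S(T)$ is integrable and $$\frac1{N^2}\,\mathbb E\big[\mathrm{Regret}_S(T)\big]\ \le\ C\,G^2\,(1+\log T)^k\,\frac{N^{1/3}\,T^{2/3}}{K^{4/3}} .$$ That is, the expected static regret is $\tilde O\big(N^{1/3}T^{2/3}/K^{4/3}\big)$ up to the normalization $1/N^2$; in particular, when $\lambda_i=1/N$ and $\|g_i^t\|\le G_0$ (with $G=G_0/N$), $\mathbb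 E[\mathrm{Regret}_S(T)]\le C\,G_0^2(1+\log T)^k\,N^{1/3}T^{2/3}/K^{4/3}$. -/

import Mathlib

open MeasureTheory ProbabilityTheory

namespace KVib

/-- Sampling probabilities over `N` clients with expected sample size `K`:
`0 < p i ≤ 1` and `∑ i, p i = K`. -/
def feasible (N : ℕ) (K : ℝ) : Set (Fin N → ℝ) :=
  {p | (∀ i, 0 < p i ∧ p i ≤ 1) ∧ ∑ i, p i = K}

/-- Online cost `ℓ(p) = ∑ i, π(i)² / p i` of the feedback vector `π`. -/
noncomputable def cost {N : ℕ} (π p : Fin N → ℝ) : ℝ := ∑ i, π i ^ 2 / p i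

/-- `p` solves the follow-the-regularized-leader problem: it minimizes
`∑ i, (w i + γ) / p i` over the sampling probabilities with budget `K`. -/
def IsFTRL {N : ℕ} (K γ : ℝ) (w p : Fin N → ℝ) : Prop :=
  p ∈ feasible N K ∧ ∀ q ∈ feasible N K, ∑ i, (w i + γ) / p i ≤ ∑ i, (w i + γ) / q i

/-- Mixed distribution `(1 - θ) p + θ K / N`. -/
noncomputable def mix {N : ℕ} (K θ : ℝ) (p : Fin N → ℝ) : Fin N → ℝ :=
  fun i => (1 - θ) * p i + θ * (K / N)

/-- Importance-weighted squared feedback: `π(i)² / q i` if `i` was sampled, `0` otherwise. -/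
noncomputable def estimate {N : ℕ} (π q : Fin N → ℝ) (A : Finset (Fin N)) : Fin N → ℝ :=
  fun i => if i ∈ A then π i ^ 2 / q i else 0

/-- Probability that independent coin flips with success probabilities `q` select exactly `A`. -/
noncomputable def ispProb {N : ℕ} (q : Fin N → ℝ) (A : Finset (Fin N)) : ℝ :=
  (∏ i ∈ A, q i) * ∏ i ∈ Aᶜ, (1 - q i)

/-- Static regret over `T` rounds of playing `q 0, …, q (T - 1)` against the best fixed
sampling probability in hindsight (an infimum, as `feasible N K` is not closed). -/
noncomputable def staticRegret {N : ℕ} (K : ℝ) (T : ℕ) (π q : ℕ → Fin N → ℝ) : ℝ :=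
  (∑ t ∈ Finset.range T, cost (π t) (q t)) -
    sInf ((fun p => ∑ t ∈ Finset.range T, cost (π t) p) '' feasible N K)

/-- The feedback of every client converges at rate `O(1 / √t)`
(index `t` is the round with number `t + 1`). -/
def ConvergentFeedback {N : ℕ} (π : ℕ → Fin N → ℝ) : Prop :=
  ∃ (πstar : Fin N → ℝ) (c : ℝ), ∀ t i, |π t i - πstar i| ≤ c / √((t : ℝ) + 1)

/-- Local feedback `π_t(i) = lam i * ‖g_i^t‖`. -/
noncomputable def feedback {N d : ℕ} (lam : Fin N → ℝ)
    (g : ℕ → Fin N → EuclideanSpace ℝ (Fin d)) : ℕ → Fin N → ℝ :=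
  fun t i => lam i * ‖g t i‖

/-- The processes `p` and `S` form a run of the K-Vib sampler for `T` rounds on the (possibly
random, history-dependent) feedback `π`. The σ-algebra `ℱ t` carries the information present just
before the clients of round `t` are drawn, including the local updates of that round. -/
structure IsRun {Ω : Type*} {mΩ : MeasurableSpace Ω} (μ : Measure Ω) (ℱ : Filtration ℕ mΩ)
    {N : ℕ} (K θ γ : ℝ) (T : ℕ) (π : Ω → ℕ → Fin N → ℝ)
    (p : Ω → ℕ → Fin N → ℝ) (S : Ω → ℕ → Finset (Fin N)) : Prop where
  /-- `p t` is the FTRL solution for the estimated feedback of the earlier rounds. -/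
  ftrl : ∀ t < T, ∀ ω, IsFTRL K γ
    (fun i => ∑ s ∈ Finset.range t, estimate (π ω s) (mix K θ (p ω s)) (S ω s) i) (p ω t)
  /-- The sample of round `t` is known afterwards. -/
  sample_meas : ∀ t < T, ∀ A : Finset (Fin N), MeasurableSet[ℱ (t + 1)] {ω | S ω t = A}
  /-- Given the past, the clients are drawn independently with the mixed probabilities. -/
  sample_law : ∀ t < T, ∀ A : Finset (Fin N),
    μ[Set.indicator {ω | S ω t = A} (fun _ => (1 : ℝ)) | ℱ t]
      =ᵐ[μ] fun ω => ispProb (mix K θ (p ω t)) A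

end KVib

namespace KVib

lemma inv_tradeoff_min {c l y : ℝ} (hc : 0 < c) (hl : 0 ≤ l) (hy : 1 ≤ y) :
    c * max 1 (l / √c) + l ^ 2 / max 1 (l / √c) ≤ c * y + l ^ 2 / y := by
  have hs : 0 < √c := Real.sqrt_pos.2 hc
  have hsq : √c ^ 2 = c := Real.sq_sqrt hc.le
  have hy0 : 0 < y := by linarith
  rcases le_total l √c with h | h
  · rw [max_eq_left ((div_le_one hs).2 h)]
    have h1 : l ^ 2 ≤ c := by rw [← hsq]; gcongr
    have h2 : l ^ 2 / y ≤ c := (div_le_self (sq_nonneg l) hy).trans h1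
    have h3 : l ^ 2 = l ^ 2 / y * y := by field_simp
    nlinarith [mul_nonneg (sub_nonneg.2 hy) (sub_nonneg.2 h2)]
  · rw [max_eq_right ((one_le_div hs).2 h)]
    have hl0 : 0 < l := hs.trans_le h
    have h1 : c * (l / √c) = l * √c := by
      rw [← hsq, Real.sqrt_sq hs.le]; field_simp
    have h2 : l ^ 2 / (l / √c) = l * √c := by field_simp
    rw [h1, h2]
    have h3 : c * y + l ^ 2 / y - (l * √c + l * √c) = (√c * y - l) ^ 2 / y := by
      field_simp
      rw [← hsq, Real.sqrt_sq hs.le]; ring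
    have : 0 ≤ (√c * y - l) ^ 2 / y := by positivity
    linarith

/-- Tangent inequality for the concave function `c ↦ min_q (c / q + l² q)`. -/
lemma inv_tradeoff_tangent {c x l q : ℝ} (hc : 0 < c) (hx : 0 ≤ x) (hl : 0 ≤ l) (hq : 0 < q)
    (hq1 : q ≤ 1) :
    c * max 1 (l / √c) + l ^ 2 / max 1 (l / √c) + x * max 1 (l / √(c + x))
      ≤ (c + x) / q + l ^ 2 * q := by
  have h1 := inv_tradeoff_min (c := c + x) (by linarith) hl ((one_le_inv₀ hq).2 hq1)
  have h2 := inv_tradeoff_min hc hl (le_max_left 1 (l / √(c + x)))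
  have h3 : (c + x) / q + l ^ 2 * q = (c + x) * q⁻¹ + l ^ 2 / q⁻¹ := by
    rw [div_inv_eq_mul, div_eq_mul_inv]
  rw [h3]
  nlinarith

variable {N : ℕ} {K γ : ℝ}

/-- First-order optimality by moving mass from coordinate `j` to coordinate `i`. -/
lemma exchange_optimality {c p : Fin N → ℝ} (hp : p ∈ feasible N K)
    (hmin : ∀ q ∈ feasible N K, ∑ i, c i / p i ≤ ∑ i, c i / q i)
    {i : Fin N} (hi : p i < 1) (j : Fin N) : c i * p j ^ 2 ≤ c j * p i ^ 2 := by
  classical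
  rcases eq_or_ne i j with rfl | hij
  · rfl
  have hpi := (hp.1 i).1
  have hpj := (hp.1 j).1
  have key : ∀ᶠ e in nhdsWithin (0 : ℝ) (Set.Ioi 0),
      c i * (p j * (p j - e)) ≤ c j * (p i * (p i + e)) := by
    have hlt : 0 < min (1 - p i) (p j) := lt_min (by linarith) hpj
    filter_upwards [Ioo_mem_nhdsGT hlt] with e he
    have he0 := he.1
    have he1 : e < 1 - p i := he.2.trans_le (min_le_left _ _)
    have he2 : e < p j := he.2.trans_le (min_le_right _ _)
    set q : Fin N → ℝ := p + Pi.single i e - Pi.single j e with hqdef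
    have hqi : q i = p i + e := by simp [hqdef, hij]
    have hqj : q j = p j - e := by simp [hqdef, hij.symm]
    have hqk : ∀ k, k ≠ i → k ≠ j → q k = p k := fun k h1 h2 => by simp [hqdef, h1, h2]
    have hq : q ∈ feasible N K := by
      refine ⟨fun k => ?_, ?_⟩
      · rcases eq_or_ne k i with rfl | h1
        · rw [hqi]; exact ⟨by linarith, by linarith⟩
        rcases eq_or_ne k j with rfl | h2
        · rw [hqj]; exact ⟨by linarith, by linarith [(hp.1 k).2]⟩
        rw [hqk k h1 h2]; exact hp.1 k
      · simp [hqdef, Finset.sum_add_distrib, Finset.sum_sub_distrib, hp.2]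
    have h := hmin q hq
    have hsub : ∑ k, (c k / q k - c k / p k)
        = (c i / q i - c i / p i) + (c j / q j - c j / p j) := by
      refine Fintype.sum_eq_add i j hij fun k hk => ?_
      rw [hqk k hk.1 hk.2, sub_self]
    rw [Finset.sum_sub_distrib, hqi, hqj] at hsub
    have e1 : c i / (p i + e) - c i / p i = - (e * (c i / (p i * (p i + e)))) := by
      field_simp; ring
    have e2 : c j / (p j - e) - c j / p j = e * (c j / (p j * (p j - e))) := by
      have : p j - e ≠ 0 := by linarith
      field_simp; ring
    rw [e1, e2] at hsub
    have h2 : c i / (p i * (p i + e)) ≤ c j / (p j * (p j - e)) := by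
      have : 0 ≤ e * (c j / (p j * (p j - e)) - c i / (p i * (p i + e))) := by linarith
      linarith [nonneg_of_mul_nonneg_right this he0]
    rwa [div_le_div_iff₀ (mul_pos hpi (by linarith)) (mul_pos hpj (by linarith))] at h2
  have l1 : Filter.Tendsto (fun e => c i * (p j * (p j - e))) (nhdsWithin (0 : ℝ) (Set.Ioi 0))
      (nhds (c i * p j ^ 2)) := by
    have : Continuous fun e : ℝ => c i * (p j * (p j - e)) := by fun_prop
    simpa [sq] using (this.tendsto 0).mono_left nhdsWithin_le_nhds
  have l2 : Filter.Tendsto (fun e => c j * (p i * (p i + e))) (nhdsWithin (0 : ℝ) (Set.Ioi 0))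
      (nhds (c j * p i ^ 2)) := by
    have : Continuous fun e : ℝ => c j * (p i * (p i + e)) := by fun_prop
    simpa [sq] using (this.tendsto 0).mono_left nhdsWithin_le_nhds
  exact le_of_tendsto_of_tendsto l1 l2 key

/-- Water-filling form of the minimizer of `∑ c i / p i` over the sampling probabilities. -/
lemma exists_multiplier {c p : Fin N → ℝ} (hc : ∀ i, 0 < c i) (hp : p ∈ feasible N K)
    (hmin : ∀ q ∈ feasible N K, ∑ i, c i / p i ≤ ∑ i, c i / q i) :
    ∃ l : ℝ, 0 ≤ l ∧ l * K ≤ ∑ i, √(c i) ∧ ∀ i, (p i)⁻¹ = max 1 (l / √(c i)) := by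
  have hs : ∀ i, 0 < √(c i) := fun i => Real.sqrt_pos.2 (hc i)
  by_cases hall : ∀ i, p i = 1
  · exact ⟨0, le_rfl, by simpa using Finset.sum_nonneg fun i _ => (hs i).le,
      fun i => by simp [hall i]⟩
  push Not at hall
  obtain ⟨i₀, hi₀⟩ := hall
  have hlt : p i₀ < 1 := lt_of_le_of_ne (hp.1 i₀).2 hi₀
  have cmp : ∀ i j, p i < 1 → √(c i) * p j ≤ √(c j) * p i := fun i j hi => by
    have := Real.sqrt_le_sqrt (exchange_optimality hp hmin hi j)
    rwa [Real.sqrt_mul (hc i).le, Real.sqrt_mul (hc j).le, Real.sqrt_sq (hp.1 j).1.le,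
      Real.sqrt_sq (hp.1 i).1.le] at this
  have h0 := (hp.1 i₀).1
  have hle : ∀ j, √(c i₀) / p i₀ * p j ≤ √(c j) := fun j => by
    rw [div_mul_eq_mul_div, div_le_iff₀ h0]; exact cmp i₀ j hlt
  refine ⟨√(c i₀) / p i₀, by positivity, ?_, fun j => ?_⟩
  · rw [← hp.2, Finset.mul_sum]
    exact Finset.sum_le_sum fun j _ => hle j
  · have hj := (hp.1 j).1
    rcases (hp.1 j).2.eq_or_lt with h1 | h1
    · have := hle j
      rw [h1, mul_one] at this
      rw [h1, inv_one, max_eq_left ((div_le_one (hs j)).2 this)]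
    · have h2 : √(c i₀) * p j = √(c j) * p i₀ := le_antisymm (cmp i₀ j hlt) (cmp j i₀ h1)
      have h3 : √(c i₀) / p i₀ / √(c j) = (p j)⁻¹ := by
        have := (hs j).ne'
        field_simp; linarith
      rw [h3, max_eq_right ((one_le_inv₀ hj).2 h1.le)]

/-- One step of follow-the-regularized-leader: lower bound on the value of the updated problem. -/
lemma leader_step {c p x q : Fin N → ℝ} {A : ℝ} (hK : 0 < K) (hc : ∀ i, 0 < c i)
    (hp : p ∈ feasible N K) (hmin : ∀ q ∈ feasible N K, ∑ i, c i / p i ≤ ∑ i, c i / q i)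
    (hx : ∀ i, 0 ≤ x i) (hxγ : ∀ i, x i ≤ γ) (hA : ∑ i, √(c i) ≤ A) (hq : q ∈ feasible N K) :
    ∑ i, c i / p i + ∑ i, x i / p i
      ≤ ∑ i, (c i + x i) / q i + A / K * ∑ i, γ * ((√(c i))⁻¹ - (√(c i + x i))⁻¹) := by
  obtain ⟨l, hl, hlK, hinv⟩ := exists_multiplier hc hp hmin
  have hlA : l ≤ A / K := by rw [le_div_iff₀ hK]; linarith
  have hpt : ∀ i, c i / p i + x i / p i + l ^ 2 * p i
      ≤ (c i + x i) / q i + l ^ 2 * q i + A / K * (γ * ((√(c i))⁻¹ - (√(c i + x i))⁻¹)) := by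
    intro i
    have h := inv_tradeoff_tangent (hc i) (hx i) hl (hq.1 i).1 (hq.1 i).2
    rw [← hinv i, div_inv_eq_mul, ← div_eq_mul_inv] at h
    have hs := Real.sqrt_pos.2 (hc i)
    have hs' : √(c i) ≤ √(c i + x i) := Real.sqrt_le_sqrt (by linarith [hx i])
    have hd : 0 ≤ (√(c i))⁻¹ - (√(c i + x i))⁻¹ := sub_nonneg.2 (inv_anti₀ hs hs')
    have hmax : (p i)⁻¹ ≤ max 1 (l / √(c i + x i))
        + l * ((√(c i))⁻¹ - (√(c i + x i))⁻¹) := by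
      rw [hinv i, mul_sub, ← div_eq_mul_inv, ← div_eq_mul_inv]
      have hd' : l / √(c i + x i) ≤ l / √(c i) := div_le_div_of_nonneg_left hl hs hs'
      exact max_le (by linarith [le_max_left 1 (l / √(c i + x i))])
        (by linarith [le_max_right 1 (l / √(c i + x i))])
    have h2 : x i / p i ≤ x i * max 1 (l / √(c i + x i))
        + x i * (l * ((√(c i))⁻¹ - (√(c i + x i))⁻¹)) := by
      rw [div_eq_mul_inv, ← mul_add]; exact mul_le_mul_of_nonneg_left hmax (hx i)
    have h3 : x i * (l * ((√(c i))⁻¹ - (√(c i + x i))⁻¹))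
        ≤ γ * (A / K * ((√(c i))⁻¹ - (√(c i + x i))⁻¹)) := by
      have : 0 ≤ γ := (hx i).trans (hxγ i)
      gcongr
      exact hxγ i
    linarith
  have hsum := Finset.sum_le_sum fun i (_ : i ∈ Finset.univ) => hpt i
  simp only [Finset.sum_add_distrib, ← Finset.mul_sum, hp.2, hq.2] at hsum ⊢
  linarith

/-- Regret bound of follow-the-regularized-leader for loss increments bounded by the
regularization parameter. -/
lemma leader_regret {T : ℕ} {x p : ℕ → Fin N → ℝ} {q : Fin N → ℝ} (hK : 0 < K) (hγ : 0 < γ)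
    (hp : ∀ t < T, IsFTRL K γ (fun i => ∑ s ∈ Finset.range t, x s i) (p t))
    (hx : ∀ t < T, ∀ i, 0 ≤ x t i) (hxγ : ∀ t < T, ∀ i, x t i ≤ γ) (hq : q ∈ feasible N K) :
    ∑ t ∈ Finset.range T, ∑ i, x t i / p t i
      ≤ ∑ i, (∑ s ∈ Finset.range T, x s i + γ) / q i
        + N / K * (√γ * ∑ i, √(∑ s ∈ Finset.range T, x s i + γ)) := by
  set c : ℕ → Fin N → ℝ := fun t i => ∑ s ∈ Finset.range t, x s i + γ with hcdef
  set A : ℝ := ∑ i, √(c T i) with hAdef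
  have hcpos : ∀ t ≤ T, ∀ i, 0 < c t i := fun t ht i => by
    have : 0 ≤ ∑ s ∈ Finset.range t, x s i :=
      Finset.sum_nonneg fun s hs => hx s ((Finset.mem_range.1 hs).trans_le ht) i
    simp only [hcdef]; linarith
  have hcT : ∀ t ≤ T, ∀ i, c t i ≤ c T i := fun t ht i => by
    simp only [hcdef]
    have := Finset.sum_le_sum_of_subset_of_nonneg (Finset.range_subset_range.2 ht)
      fun s hs _ => hx s (Finset.mem_range.1 hs) i
    linarith
  have main : ∀ t ≤ T, ∀ q ∈ feasible N K,
      ∑ s ∈ Finset.range t, ∑ i, x s i / p s i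
        ≤ ∑ i, c t i / q i + A / K * ∑ i, γ * ((√γ)⁻¹ - (√(c t i))⁻¹) := by
    intro t
    induction t with
    | zero =>
      intro _ q hq
      have : 0 ≤ ∑ i, γ / q i := Finset.sum_nonneg fun i _ => div_nonneg hγ.le (hq.1 i).1.le
      simpa [hcdef] using this
    | succ t ih =>
      intro ht q hq
      have h1 := ih (by omega) (p t) (hp t (by omega)).1
      have hA : ∑ i, √(c t i) ≤ A :=
        Finset.sum_le_sum fun i _ => Real.sqrt_le_sqrt (hcT t (by omega) i)
      have h2 := leader_step hK (hcpos t (by omega)) (hp t (by omega)).1 (hp t (by omega)).2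
        (hx t (by omega)) (hxγ t (by omega)) hA hq
      have hc' : ∀ i, c (t + 1) i = c t i + x t i := fun i => by
        simp only [hcdef, Finset.sum_range_succ]; ring
      have h3 : A / K * ∑ i, γ * ((√γ)⁻¹ - (√(c (t + 1) i))⁻¹)
          = A / K * ∑ i, γ * ((√γ)⁻¹ - (√(c t i))⁻¹)
            + A / K * ∑ i, γ * ((√(c t i))⁻¹ - (√(c t i + x t i))⁻¹) := by
        rw [← mul_add, ← Finset.sum_add_distrib]
        congr 1
        refine Finset.sum_congr rfl fun i _ => ?_
        rw [hc']; ring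
      rw [h3, Finset.sum_range_succ]
      simp only [hc']
      linarith
  have h := main T le_rfl q hq
  have hA0 : 0 ≤ A := Finset.sum_nonneg fun i _ => Real.sqrt_nonneg _
  have h4 : A / K * ∑ i, γ * ((√γ)⁻¹ - (√(c T i))⁻¹) ≤ N / K * (√γ * A) := by
    have : ∑ i, γ * ((√γ)⁻¹ - (√(c T i))⁻¹) ≤ ∑ _i : Fin N, √γ := by
      refine Finset.sum_le_sum fun i _ => ?_
      have h5 : γ * (√γ)⁻¹ = √γ := by
        have := Real.sqrt_pos.2 hγ
        field_simp; exact (Real.sq_sqrt hγ.le).symm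
      have : 0 ≤ γ * (√(c T i))⁻¹ := by positivity
      rw [mul_sub, h5]; linarith
    rw [Finset.sum_const, Finset.card_univ, Fintype.card_fin, nsmul_eq_mul] at this
    calc _ ≤ A / K * (N * √γ) := by gcongr
      _ = _ := by ring
  linarith

lemma sq_add_div_mix {θ x y q u : ℝ} (hθ : 0 < θ) (hθ1 : θ ≤ 1) (hq : 0 < q) (hu : 0 < u) :
    (1 - θ) * ((x + y) ^ 2 / ((1 - θ) * q + θ * u)) ≤ x ^ 2 / q + y ^ 2 / (θ * u) := by
  have hd : 0 < (1 - θ) * q + θ * u := by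
    have := mul_nonneg (sub_nonneg.2 hθ1) hq.le
    have := mul_pos hθ hu
    linarith
  rw [← mul_div_assoc, div_add_div _ _ hq.ne' (mul_pos hθ hu).ne', div_le_div_iff₀ hd (by positivity)]
  obtain ⟨β, rfl⟩ : ∃ β, θ = 1 - β := ⟨1 - θ, by ring⟩
  have hβ : 0 ≤ β := by linarith
  set v := (1 - β) * u with hv
  have hv0 : 0 < v := mul_pos hθ hu
  have e : (x ^ 2 * v + q * y ^ 2) * ((1 - (1 - β)) * q + v)
      - (1 - (1 - β)) * (x + y) ^ 2 * (q * v)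
      = (x * v - β * q * y) ^ 2 + (1 - β) * β * q ^ 2 * y ^ 2 + (1 - β) * q * v * y ^ 2 := by
    ring
  have : 0 ≤ (x * v - β * q * y) ^ 2 + (1 - β) * β * q ^ 2 * y ^ 2
      + (1 - β) * q * v * y ^ 2 := by positivity
  linarith

lemma mix_mem_feasible {θ : ℝ} {q : Fin N → ℝ} (hK : 0 < K) (hKN : K ≤ N) (hθ : 0 < θ)
    (hθ1 : θ ≤ 1) (hq : q ∈ feasible N K) : mix K θ q ∈ feasible N K := by
  have hN : (0 : ℝ) < N := hK.trans_le hKN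
  refine ⟨fun i => ⟨?_, ?_⟩, ?_⟩
  · have := mul_nonneg (sub_nonneg.2 hθ1) (hq.1 i).1.le
    have : 0 < θ * (K / N) := by positivity
    simp only [mix]; linarith
  · have h1 : K / N ≤ 1 := (div_le_one hN).2 hKN
    simp only [mix]
    nlinarith [mul_le_mul_of_nonneg_left (hq.1 i).2 (sub_nonneg.2 hθ1)]
  · simp only [mix, Finset.sum_add_distrib, ← Finset.mul_sum, hq.2, Finset.sum_const,
      Finset.card_univ, Fintype.card_fin, nsmul_eq_mul]
    field_simp; ring

lemma uniform_mem_feasible (hK : 0 < K) (hKN : K ≤ N) :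
    (fun _ => K / N : Fin N → ℝ) ∈ feasible N K := by
  have hN : (0 : ℝ) < N := hK.trans_le hKN
  refine ⟨fun i => ⟨by positivity, (div_le_one hN).2 hKN⟩, ?_⟩
  simp only [Finset.sum_const, Finset.card_univ, Fintype.card_fin, nsmul_eq_mul]
  field_simp

lemma sqrt_le_sqrt_add_deviation {v w : ℝ} (hγ : 0 < γ) (hv : 0 ≤ v) (hw : 0 ≤ w) :
    √(v + γ) ≤ √w + (√γ + |v - w| / √(w + γ)) := by
  have hb : 0 < √(w + γ) := Real.sqrt_pos.2 (by linarith)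
  have ha : 0 ≤ √(v + γ) := Real.sqrt_nonneg _
  have h1 : √(v + γ) ≤ √(w + γ) + |v - w| / √(w + γ) := by
    rw [← sub_le_iff_le_add', le_div_iff₀ hb]
    have e : (√(v + γ) - √(w + γ)) * (√(v + γ) + √(w + γ)) = v - w := by
      ring_nf
      rw [Real.sq_sqrt (by linarith), Real.sq_sqrt (by linarith)]; ring
    rcases le_total √(v + γ) √(w + γ) with h | h
    · exact (mul_nonpos_of_nonpos_of_nonneg (by linarith) hb.le).trans (abs_nonneg _)
    · refine le_trans ?_ (le_abs_self _)
      rw [← e]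
      exact mul_le_mul_of_nonneg_left (by linarith) (by linarith)
  have h2 : √(w + γ) ≤ √w + √γ := by
    rw [Real.sqrt_le_left (by positivity), add_sq, Real.sq_sqrt hw, Real.sq_sqrt hγ.le]
    have := mul_nonneg (Real.sqrt_nonneg w) (Real.sqrt_nonneg γ)
    linarith
  linarith

/-- The regularized problem for `v`, compared with the problem for `w`. -/
lemma regularized_comparator {θ : ℝ} {v w q : Fin N → ℝ} (hK : 0 < K) (hKN : K ≤ N) (hθ : 0 < θ)
    (hθ1 : θ ≤ 1) (hγ : 0 < γ) (hv : ∀ i, 0 ≤ v i) (hw : ∀ i, 0 ≤ w i) (hq : q ∈ feasible N K) :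
    (1 - θ) * ∑ i, (v i + γ) / mix K θ q i
      ≤ ∑ i, w i / q i + N / (θ * K) * ∑ i, (2 * γ + 2 * ((v i - w i) ^ 2 / (w i + γ))) := by
  have hN : (0 : ℝ) < N := hK.trans_le hKN
  rw [Finset.mul_sum, Finset.mul_sum, ← Finset.sum_add_distrib]
  refine Finset.sum_le_sum fun i _ => ?_
  have hm := (mix_mem_feasible hK hKN hθ hθ1 hq).1 i
  have hwγ : 0 < w i + γ := by linarith [hw i]
  set y := √γ + |v i - w i| / √(w i + γ) with hy
  have hle := sqrt_le_sqrt_add_deviation hγ (hv i) (hw i)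
  have h1 : v i + γ ≤ (√(w i) + y) ^ 2 := by
    rw [← Real.sq_sqrt (show 0 ≤ v i + γ by linarith [hv i])]
    gcongr
  have h2 : y ^ 2 ≤ 2 * γ + 2 * ((v i - w i) ^ 2 / (w i + γ)) := by
    have e1 : (|v i - w i| / √(w i + γ)) ^ 2 = (v i - w i) ^ 2 / (w i + γ) := by
      rw [div_pow, sq_abs, Real.sq_sqrt hwγ.le]
    rw [hy, ← e1]
    nlinarith [sq_nonneg (√γ - |v i - w i| / √(w i + γ)), Real.sq_sqrt hγ.le]
  calc (1 - θ) * ((v i + γ) / mix K θ q i)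
      ≤ (1 - θ) * ((√(w i) + y) ^ 2 / mix K θ q i) := by
        have := hm.1
        have : 0 ≤ 1 - θ := by linarith
        gcongr
    _ ≤ √(w i) ^ 2 / q i + y ^ 2 / (θ * (K / N)) :=
        sq_add_div_mix hθ hθ1 (hq.1 i).1 (by positivity)
    _ = w i / q i + N / (θ * K) * y ^ 2 := by
        rw [Real.sq_sqrt (hw i)]; field_simp
    _ ≤ _ := by gcongr

lemma inv_mix_le {θ q u : ℝ} (hθ : 0 < θ) (hθ1 : θ ≤ 1) (hq : 0 < q) (hu : 0 < u) :
    ((1 - θ) * q + θ * u)⁻¹ ≤ (1 - θ) / q + θ / u := by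
  have hd : 0 < (1 - θ) * q + θ * u := by
    have := mul_nonneg (sub_nonneg.2 hθ1) hq.le
    have := mul_pos hθ hu
    linarith
  rw [div_add_div _ _ hq.ne' hu.ne', inv_eq_one_div, div_le_div_iff₀ hd (by positivity)]
  have : 0 ≤ (1 - θ) * θ * (q - u) ^ 2 := by
    have : 0 ≤ 1 - θ := by linarith
    positivity
  nlinarith

end KVib

namespace KVib

section Expectation

variable {Ω : Type*} {mΩ : MeasurableSpace Ω} {μ : Measure Ω}

lemma integral_mul_eq_of_condExp [IsProbabilityMeasure μ] {m : MeasurableSpace Ω} (hm : m ≤ mΩ) {Y I P : Ω → ℝ}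
    (hYm : AEStronglyMeasurable[m] Y μ) (hY : MemLp Y ⊤ μ) (hI : MemLp I ⊤ μ)
    (hP : μ[I | m] =ᵐ[μ] P) : ∫ ω, Y ω * I ω ∂μ = ∫ ω, Y ω * P ω ∂μ := by
  have hYI : MemLp (Y * I) ⊤ μ := hI.mul hY
  have h := condExp_mul_of_aestronglyMeasurable_left hYm (hYI.integrable le_top)
    (hI.integrable le_top)
  calc ∫ ω, Y ω * I ω ∂μ = ∫ ω, (μ[Y * I | m]) ω ∂μ := (integral_condExp hm).symm
    _ = ∫ ω, Y ω * P ω ∂μ := by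
      refine integral_congr_ae ?_
      filter_upwards [h, hP] with ω h1 h2
      rw [h1, Pi.mul_apply, h2]

lemma aestronglyMeasurable_sum_subalgebra {ι : Type*} {m : MeasurableSpace Ω} {s : Finset ι}
    {f : ι → Ω → ℝ} (hf : ∀ i ∈ s, AEStronglyMeasurable[m] (f i) μ) :
    AEStronglyMeasurable[m] (fun ω => ∑ i ∈ s, f i ω) μ := by
  classical
  induction s using Finset.induction_on with
  | empty => simpa using aestronglyMeasurable_const
  | insert a s ha ih =>
    simp only [Finset.sum_insert ha]
    exact (hf a (Finset.mem_insert_self a s)).add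
      (ih fun i hi => hf i (Finset.mem_insert_of_mem hi))

/-- A non-negative scalar process `f`, observed at round `t` with conditional probability `P t`;
`I t` is the indicator of the observation. -/
structure IsObserved (μ : Measure Ω) (ℱ : Filtration ℕ mΩ) (T : ℕ) (B γ : ℝ)
    (f P I : ℕ → Ω → ℝ) : Prop where
  f_meas : ∀ t < T, AEStronglyMeasurable[ℱ t] (f t) μ
  P_meas : ∀ t < T, AEStronglyMeasurable[ℱ t] (P t) μ
  I_meas : ∀ t < T, AEStronglyMeasurable[ℱ (t + 1)] (I t) μ
  f_mem : ∀ t < T, ∀ᵐ ω ∂μ, 0 ≤ f t ω ∧ f t ω ≤ B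
  P_pos : ∀ t < T, ∀ᵐ ω ∂μ, 0 < P t ω ∧ P t ω ≤ 1
  ratio_le : ∀ t < T, ∀ᵐ ω ∂μ, f t ω / P t ω ≤ γ
  I_mem : ∀ t ω, I t ω = 0 ∨ I t ω = 1
  condExp_eq : ∀ t < T, μ[I t | ℱ t] =ᵐ[μ] P t

namespace IsObserved

variable {ℱ : Filtration ℕ mΩ} {T : ℕ} {B γ : ℝ} {f P I : ℕ → Ω → ℝ}

lemma memLp_f (h : IsObserved μ ℱ T B γ f P I) {t : ℕ} (ht : t < T) : MemLp (f t) ⊤ μ := by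
  refine memLp_top_of_bound ((h.f_meas t ht).mono (ℱ.le t)) B ?_
  filter_upwards [h.f_mem t ht] with ω hω
  rw [Real.norm_of_nonneg hω.1]; exact hω.2

lemma memLp_I (h : IsObserved μ ℱ T B γ f P I) {t : ℕ} (ht : t < T) : MemLp (I t) ⊤ μ := by
  refine memLp_top_of_bound ((h.I_meas t ht).mono (ℱ.le _)) 1 (ae_of_all _ fun ω => ?_)
  rcases h.I_mem t ω with h | h <;> simp [h]

lemma memLp_ratio (h : IsObserved μ ℱ T B γ f P I) {t : ℕ} (ht : t < T) :
    MemLp (f t / P t) ⊤ μ := by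
  refine memLp_top_of_bound (((h.f_meas t ht).div₀ (h.P_meas t ht)).mono (ℱ.le t)) γ ?_
  filter_upwards [h.f_mem t ht, h.P_pos t ht, h.ratio_le t ht] with ω h1 h2 h3
  rw [Pi.div_apply, Real.norm_of_nonneg (div_nonneg h1.1 h2.1.le)]; exact h3

lemma memLp_estimate (h : IsObserved μ ℱ T B γ f P I) {t : ℕ} (ht : t < T) :
    MemLp (f t / P t * I t) ⊤ μ := (h.memLp_I ht).mul (h.memLp_ratio ht)

lemma sum_nonneg (h : IsObserved μ ℱ T B γ f P I) {t : ℕ} (ht : t ≤ T) :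
    ∀ᵐ ω ∂μ, 0 ≤ ∑ s ∈ Finset.range t, f s ω := by
  have : ∀ᵐ ω ∂μ, ∀ s ∈ Finset.range t, 0 ≤ f s ω := by
    rw [Filter.eventually_all_finset]
    intro s hs
    exact (h.f_mem s ((Finset.mem_range.1 hs).trans_le ht)).mono fun ω hω => hω.1
  exact this.mono fun ω hω => Finset.sum_nonneg hω

lemma sum_le (h : IsObserved μ ℱ T B γ f P I) {t : ℕ} (ht : t ≤ T) :
    ∀ᵐ ω ∂μ, ∑ s ∈ Finset.range t, f s ω ≤ t * B := by
  have : ∀ᵐ ω ∂μ, ∀ s ∈ Finset.range t, f s ω ≤ B := by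
    rw [Filter.eventually_all_finset]
    intro s hs
    exact (h.f_mem s ((Finset.mem_range.1 hs).trans_le ht)).mono fun ω hω => hω.2
  exact this.mono fun ω hω => by simpa using Finset.sum_le_sum hω

lemma memLp_sum (h : IsObserved μ ℱ T B γ f P I) {t : ℕ} (ht : t ≤ T) :
    MemLp (fun ω => ∑ s ∈ Finset.range t, f s ω) ⊤ μ :=
  memLp_finsetSum _ fun _ hs => h.memLp_f ((Finset.mem_range.1 hs).trans_le ht)

lemma memLp_sum_estimate (h : IsObserved μ ℱ T B γ f P I) {t : ℕ} (ht : t ≤ T) :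
    MemLp (fun ω => ∑ s ∈ Finset.range t, f s ω / P s ω * I s ω) ⊤ μ :=
  memLp_finsetSum _ fun _ hs => h.memLp_estimate ((Finset.mem_range.1 hs).trans_le ht)

lemma sum_f_meas (h : IsObserved μ ℱ T B γ f P I) {t u : ℕ} (hu : u ≤ T) (htu : u ≤ t + 1) :
    AEStronglyMeasurable[ℱ t] (fun ω => ∑ s ∈ Finset.range u, f s ω) μ := by
  refine aestronglyMeasurable_sum_subalgebra fun s hs => ?_
  have hs := Finset.mem_range.1 hs
  exact (h.f_meas s (by omega)).mono (ℱ.mono (by omega))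

lemma sum_estimate_meas (h : IsObserved μ ℱ T B γ f P I) {t : ℕ} (ht : t ≤ T) :
    AEStronglyMeasurable[ℱ t] (fun ω => ∑ s ∈ Finset.range t, f s ω / P s ω * I s ω) μ := by
  refine aestronglyMeasurable_sum_subalgebra fun s hs => ?_
  have hs := Finset.mem_range.1 hs
  exact (((h.f_meas s (by omega)).div₀ (h.P_meas s (by omega))).mono (ℱ.mono hs.le)).mul
    ((h.I_meas s (by omega)).mono (ℱ.mono hs))

lemma inv_meas (h : IsObserved μ ℱ T B γ f P I) {t u : ℕ} (hu : u ≤ T) (htu : u ≤ t + 1) :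
    AEStronglyMeasurable[ℱ t] (fun ω => (∑ s ∈ Finset.range u, f s ω + γ)⁻¹) μ :=
  ((h.sum_f_meas hu htu).add aestronglyMeasurable_const).inv₀

lemma memLp_inv (h : IsObserved μ ℱ T B γ f P I) (hγ : 0 < γ) {t : ℕ} (ht : t ≤ T) :
    MemLp (fun ω => (∑ s ∈ Finset.range t, f s ω + γ)⁻¹) ⊤ μ := by
  refine memLp_top_of_bound ((h.inv_meas ht (t.le_succ)).mono (ℱ.le t)) γ⁻¹ ?_
  filter_upwards [h.sum_nonneg ht] with ω hω
  rw [Real.norm_of_nonneg (inv_nonneg.2 (by linarith))]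
  exact inv_anti₀ hγ (by linarith)

lemma memLp_deviation (h : IsObserved μ ℱ T B γ f P I) (hγ : 0 < γ) {t : ℕ} (ht : t ≤ T) :
    MemLp (fun ω => (∑ s ∈ Finset.range t, f s ω / P s ω * I s ω
      - ∑ s ∈ Finset.range t, f s ω) ^ 2 / (∑ s ∈ Finset.range t, f s ω + γ)) ⊤ μ := by
  have hM := (h.memLp_sum_estimate ht).sub (h.memLp_sum ht)
  have : MemLp _ ⊤ μ := (h.memLp_inv hγ ht).mul (r := ⊤) (hM.mul (r := ⊤) hM)
  refine this.ae_eq (ae_of_all _ fun ω => ?_)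
  simp [sq, div_eq_mul_inv]

variable [IsProbabilityMeasure μ]

lemma integral_estimate (h : IsObserved μ ℱ T B γ f P I) {t : ℕ} (ht : t < T) :
    ∫ ω, f t ω / P t ω * I t ω ∂μ = ∫ ω, f t ω ∂μ := by
  have := integral_mul_eq_of_condExp (ℱ.le t) ((h.f_meas t ht).div₀ (h.P_meas t ht))
    (h.memLp_ratio ht) (h.memLp_I ht) (h.condExp_eq t ht)
  refine this.trans (integral_congr_ae ?_)
  filter_upwards [h.P_pos t ht] with ω hω
  rw [Pi.div_apply, div_mul_cancel₀ _ hω.1.ne']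

lemma integral_estimate_mul (h : IsObserved μ ℱ T B γ f P I) {t : ℕ} (ht : t < T) {r : Ω → ℝ}
    (hr : AEStronglyMeasurable[ℱ t] r μ) (hr' : MemLp r ⊤ μ) :
    ∫ ω, f t ω / P t ω * I t ω * r ω ∂μ = ∫ ω, f t ω * r ω ∂μ := by
  have := integral_mul_eq_of_condExp (ℱ.le t)
    (((h.f_meas t ht).div₀ (h.P_meas t ht)).mul hr) (hr'.mul (h.memLp_ratio ht)) (h.memLp_I ht)
    (h.condExp_eq t ht)
  calc _ = _ := integral_congr_ae (ae_of_all _ fun ω => by simp; ring)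
    _ = _ := this
    _ = _ := by
      refine integral_congr_ae ?_
      filter_upwards [h.P_pos t ht] with ω hω
      have := hω.1.ne'
      simp only [Pi.mul_apply, Pi.div_apply]
      field_simp

lemma integrable_log (h : IsObserved μ ℱ T B γ f P I) (hγ : 0 < γ) {t : ℕ} (ht : t ≤ T) :
    Integrable (fun ω => Real.log (∑ s ∈ Finset.range t, f s ω + γ)) μ := by
  refine Integrable.of_bound ?_ (|Real.log γ| + |Real.log (t * B + γ)|) ?_
  · exact (Real.measurable_log.comp_aemeasurable
      ((((h.sum_f_meas ht t.le_succ).mono (ℱ.le t)).aemeasurable).add_const γ)).aestronglyMeasurable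
  · filter_upwards [h.sum_nonneg ht, h.sum_le ht] with ω h1 h2
    have e1 := Real.log_le_log hγ (show γ ≤ ∑ s ∈ Finset.range t, f s ω + γ by linarith)
    have e2 := Real.log_le_log (by linarith)
      (show ∑ s ∈ Finset.range t, f s ω + γ ≤ t * B + γ by linarith)
    rw [Real.norm_eq_abs, abs_le]
    constructor <;> linarith [neg_abs_le (Real.log γ), abs_nonneg (Real.log γ),
      le_abs_self (Real.log (t * B + γ)), abs_nonneg (Real.log (t * B + γ))]

/-- Self-normalized second moment of the error of the importance-weighted sums. -/
lemma integral_deviation_le (h : IsObserved μ ℱ T B γ f P I) (hγ : 0 < γ) {t : ℕ} (ht : t ≤ T) :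
    ∫ ω, (∑ s ∈ Finset.range t, f s ω / P s ω * I s ω
        - ∑ s ∈ Finset.range t, f s ω) ^ 2 / (∑ s ∈ Finset.range t, f s ω + γ) ∂μ
      ≤ γ * ∫ ω, Real.log (∑ s ∈ Finset.range t, f s ω + γ) ∂μ - γ * Real.log γ := by
  induction t with
  | zero => simp
  | succ t ih =>
    have ht' : t < T := ht
    specialize ih ht'.le
    set V : Ω → ℝ := fun ω => ∑ s ∈ Finset.range t, f s ω / P s ω * I s ω with hV
    set W : Ω → ℝ := fun ω => ∑ s ∈ Finset.range t, f s ω with hW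
    set D : Ω → ℝ := fun ω => (∑ s ∈ Finset.range (t + 1), f s ω + γ)⁻¹ with hD
    have hDeq : ∀ ω, D ω = (W ω + f t ω + γ)⁻¹ := fun ω => by
      simp only [hD, hW, Finset.sum_range_succ]
    set Z : Ω → ℝ := V - W - f t with hZ
    have hZm : AEStronglyMeasurable[ℱ t] Z μ :=
      ((h.sum_estimate_meas ht'.le).sub (h.sum_f_meas ht'.le t.le_succ)).sub (h.f_meas t ht')
    have hZb : MemLp Z ⊤ μ :=
      ((h.memLp_sum_estimate ht'.le).sub (h.memLp_sum ht'.le)).sub (h.memLp_f ht')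
    have hDm : AEStronglyMeasurable[ℱ t] D μ := h.inv_meas ht le_rfl
    have hDb : MemLp D ⊤ μ := h.memLp_inv hγ ht
    have hQm : AEStronglyMeasurable[ℱ t] (f t / P t) μ := (h.f_meas t ht').div₀ (h.P_meas t ht')
    have hQb := h.memLp_ratio ht'
    set Y₀ : Ω → ℝ := Z * Z * D with hY₀
    set Y₁ : Ω → ℝ := (Z + Z + f t / P t) * (f t / P t) * D with hY₁
    have hY₀b : MemLp Y₀ ⊤ μ := hDb.mul (r := ⊤) (hZb.mul (r := ⊤) hZb)
    have hY₁m : AEStronglyMeasurable[ℱ t] Y₁ μ := (((hZm.add hZm).add hQm).mul hQm).mul hDm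
    have hY₁b : MemLp Y₁ ⊤ μ :=
      hDb.mul (r := ⊤) (hQb.mul (r := ⊤) ((hZb.add hZb).add hQb))
    have hPb : MemLp (P t) ⊤ μ := by
      refine memLp_top_of_bound ((h.P_meas t ht').mono (ℱ.le t)) 1 ?_
      filter_upwards [h.P_pos t ht'] with ω hω
      rw [Real.norm_of_nonneg hω.1.le]; exact hω.2
    have hYI : Integrable (fun ω => Y₁ ω * I t ω) μ :=
      ((h.memLp_I ht').mul (r := ⊤) hY₁b).integrable le_top
    have hYP : Integrable (fun ω => Y₁ ω * P t ω) μ := (hPb.mul (r := ⊤) hY₁b).integrable le_top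
    have e1 : ∫ ω, (∑ s ∈ Finset.range (t + 1), f s ω / P s ω * I s ω
        - ∑ s ∈ Finset.range (t + 1), f s ω) ^ 2 / (∑ s ∈ Finset.range (t + 1), f s ω + γ) ∂μ
        = ∫ ω, (Y₀ ω + Y₁ ω * P t ω) ∂μ := by
      rw [integral_add (hY₀b.integrable le_top) hYP,
        ← integral_mul_eq_of_condExp (ℱ.le t) hY₁m hY₁b (h.memLp_I ht') (h.condExp_eq t ht'),
        ← integral_add (hY₀b.integrable le_top) hYI]
      refine integral_congr_ae (ae_of_all _ fun ω => ?_)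
      simp only [hY₀, hY₁, hZ, Pi.mul_apply, Pi.add_apply, Pi.sub_apply, Pi.div_apply, hDeq,
        Finset.sum_range_succ, div_eq_mul_inv _ (_ + γ)]
      simp only [hV, hW]
      rcases h.I_mem t ω with hI | hI <;> rw [hI] <;> ring
    have e2 : ∫ ω, (Y₀ ω + Y₁ ω * P t ω) ∂μ
        ≤ ∫ ω, ((V ω - W ω) ^ 2 / (W ω + γ)
          + γ * (Real.log (∑ s ∈ Finset.range (t + 1), f s ω + γ) - Real.log (W ω + γ))) ∂μ := by
      refine integral_mono_ae ((hY₀b.integrable le_top).add hYP)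
        (((h.memLp_deviation hγ ht'.le).integrable le_top).add
          (((h.integrable_log hγ ht).sub (h.integrable_log hγ ht'.le)).const_mul γ)) ?_
      filter_upwards [h.f_mem t ht', h.P_pos t ht', h.ratio_le t ht', h.sum_nonneg ht'.le]
        with ω hf hP hr hs
      have hWω : 0 < W ω + γ := by simp only [hW]; linarith
      have hW' : 0 < W ω + f t ω + γ := by linarith [hf.1]
      have a1 : Y₀ ω + Y₁ ω * P t ω = ((V ω - W ω) ^ 2 + (f t ω / P t ω - f t ω) * f t ω)
          / (W ω + f t ω + γ) := by
        have := hP.1.ne'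
        simp only [hY₀, hY₁, hZ, Pi.mul_apply, Pi.add_apply, Pi.sub_apply, Pi.div_apply, hDeq]
        field_simp
        ring
      have a2 : (V ω - W ω) ^ 2 / (W ω + f t ω + γ) ≤ (V ω - W ω) ^ 2 / (W ω + γ) :=
        div_le_div_of_nonneg_left (sq_nonneg _) hWω (by linarith [hf.1])
      have a3 : (f t ω / P t ω - f t ω) * f t ω / (W ω + f t ω + γ)
          ≤ γ * (f t ω / (W ω + f t ω + γ)) := by
        rw [mul_div_assoc]
        exact mul_le_mul_of_nonneg_right (by linarith [hf.1]) (div_nonneg hf.1 hW'.le)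
      have a4 : f t ω / (W ω + f t ω + γ)
          ≤ Real.log (W ω + f t ω + γ) - Real.log (W ω + γ) := by
        rw [← Real.log_div hW'.ne' hWω.ne']
        refine le_trans (le_of_eq ?_) (Real.one_sub_inv_le_log_of_pos (div_pos hW' hWω))
        field_simp; ring
      have a5 : ∑ s ∈ Finset.range (t + 1), f s ω + γ = W ω + f t ω + γ := by
        simp only [hW, Finset.sum_range_succ]
      simp only [a1, add_div, a5]
      have := mul_le_mul_of_nonneg_left a4 hγ.le
      linarith
    have e3 : ∫ ω, ((V ω - W ω) ^ 2 / (W ω + γ)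
          + γ * (Real.log (∑ s ∈ Finset.range (t + 1), f s ω + γ) - Real.log (W ω + γ))) ∂μ
        = ∫ ω, (V ω - W ω) ^ 2 / (W ω + γ) ∂μ
          + γ * (∫ ω, Real.log (∑ s ∈ Finset.range (t + 1), f s ω + γ) ∂μ
            - ∫ ω, Real.log (W ω + γ) ∂μ) := by
      rw [← integral_sub (h.integrable_log hγ ht) (h.integrable_log hγ ht'.le),
        ← integral_const_mul]
      exact integral_add ((h.memLp_deviation hγ ht'.le).integrable le_top)
        (((h.integrable_log hγ ht).sub (h.integrable_log hγ ht'.le)).const_mul γ)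
    linarith

end IsObserved

end Expectation

lemma sum_ispProb_of_mem {N : ℕ} (q : Fin N → ℝ) (i : Fin N) :
    ∑ A : Finset (Fin N), (if i ∈ A then ispProb q A else 0) = q i := by
  classical
  have h := Fintype.prod_add q (fun j => if j = i then 0 else 1 - q j)
  have h1 : ∏ j, (q j + if j = i then 0 else 1 - q j) = q i := by
    rw [Fintype.prod_eq_single i]
    · simp
    · intro j hj; simp [hj]
  rw [h1] at h
  rw [h]
  refine Finset.sum_congr rfl fun A _ => ?_
  split_ifs with hA
  · rw [ispProb]
    congr 1
    refine Finset.prod_congr rfl fun j hj => ?_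
    rw [if_neg]
    rintro rfl
    exact Finset.mem_compl.1 hj hA
  · rw [Finset.prod_eq_zero (Finset.mem_compl.2 hA) (by simp), mul_zero]

section Inclusion

variable {Ω : Type*} {mΩ : MeasurableSpace Ω} {μ : Measure Ω}
  {ℱ : Filtration ℕ mΩ} {N T : ℕ} {K θ γ : ℝ} {π p : Ω → ℕ → Fin N → ℝ} {S : Ω → ℕ → Finset (Fin N)}

lemma IsRun.inclusion_meas (h : IsRun μ ℱ K θ γ T π p S) {t : ℕ} (ht : t < T) (i : Fin N) :
    StronglyMeasurable[ℱ (t + 1)] ({ω | i ∈ S ω t}.indicator fun _ => (1 : ℝ)) := by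
  refine stronglyMeasurable_const.indicator ?_
  have : {ω | i ∈ S ω t} = ⋃ A ∈ {A : Finset (Fin N) | i ∈ A}, {ω | S ω t = A} := by
    ext ω; simp
  rw [this]
  exact MeasurableSet.biUnion (Set.to_countable _) fun A _ => h.sample_meas t ht A

lemma IsRun.condExp_inclusion [IsProbabilityMeasure μ] (h : IsRun μ ℱ K θ γ T π p S) {t : ℕ} (ht : t < T) (i : Fin N) :
    μ[{ω | i ∈ S ω t}.indicator fun _ => (1 : ℝ) | ℱ t] =ᵐ[μ] fun ω => mix K θ (p ω t) i := by
  classical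
  have e : ({ω | i ∈ S ω t}.indicator fun _ => (1 : ℝ))
      = ∑ A ∈ Finset.univ.filter (fun A : Finset (Fin N) => i ∈ A),
        {ω | S ω t = A}.indicator fun _ => (1 : ℝ) := by
    ext ω
    simp [Finset.sum_apply, Set.indicator_apply, Finset.sum_ite_eq]
  have hint : ∀ A : Finset (Fin N),
      Integrable ({ω | S ω t = A}.indicator fun _ => (1 : ℝ)) μ := fun A =>
    (integrable_const 1).indicator (ℱ.le _ _ (h.sample_meas t ht A))
  rw [e]
  refine (condExp_finsetSum (fun A _ => hint A) (ℱ t)).trans ?_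
  have hall : ∀ᵐ ω ∂μ, ∀ A : Finset (Fin N),
      (μ[{ω | S ω t = A}.indicator fun _ => (1 : ℝ) | ℱ t]) ω
        = ispProb (mix K θ (p ω t)) A :=
    ae_all_iff.2 fun A => h.sample_law t ht A
  filter_upwards [hall] with ω hω
  rw [Finset.sum_apply, Finset.sum_congr rfl fun A _ => hω A, Finset.sum_filter]
  exact sum_ispProb_of_mem _ i

end Inclusion

end KVib

namespace KVib

section Pathwise

variable {N T : ℕ} {K G θ γ : ℝ}

lemma sum_cost_eq (π : ℕ → Fin N → ℝ) (q : Fin N → ℝ) :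
    ∑ t ∈ Finset.range T, cost (π t) q = ∑ i, (∑ t ∈ Finset.range T, π t i ^ 2) / q i := by
  simp only [cost, Finset.sum_div]
  exact Finset.sum_comm

lemma cost_uniform_le (hK : 0 < K) (hKN : K ≤ N) {x : Fin N → ℝ} (h0 : ∀ i, 0 ≤ x i)
    (hG : ∀ i, x i ≤ G) : cost x (fun _ => K / N) ≤ G ^ 2 * N ^ 2 / K := by
  have hN : (0 : ℝ) < N := hK.trans_le hKN
  calc cost x (fun _ => K / N) ≤ ∑ _i : Fin N, G ^ 2 / (K / N) := by
        refine Finset.sum_le_sum fun i _ => ?_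
        have := h0 i
        have := hG i
        gcongr
    _ = G ^ 2 * N ^ 2 / K := by
        rw [Finset.sum_const, Finset.card_univ, Fintype.card_fin, nsmul_eq_mul]
        field_simp

lemma cost_mix_le (hK : 0 < K) (hKN : K ≤ N) (hθ : 0 < θ) (hθ1 : θ ≤ 1) {x p : Fin N → ℝ}
    (h0 : ∀ i, 0 ≤ x i) (hG : ∀ i, x i ≤ G) (hp : p ∈ feasible N K) :
    cost x (mix K θ p) ≤ ∑ i, x i ^ 2 * ((1 - θ) / p i) + θ * (G ^ 2 * N ^ 2 / K) := by
  have hN : (0 : ℝ) < N := hK.trans_le hKN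
  have h1 : cost x (mix K θ p)
      ≤ ∑ i, x i ^ 2 * ((1 - θ) / p i) + θ * cost x (fun _ => K / N) := by
    rw [cost, cost, Finset.mul_sum, ← Finset.sum_add_distrib]
    refine Finset.sum_le_sum fun i _ => ?_
    have := mul_le_mul_of_nonneg_left
      (inv_mix_le hθ hθ1 (hp.1 i).1 (show 0 < K / N by positivity)) (sq_nonneg (x i))
    calc x i ^ 2 / mix K θ p i = x i ^ 2 * ((1 - θ) * p i + θ * (K / N))⁻¹ := div_eq_mul_inv _ _
      _ ≤ _ := this
      _ = _ := by ring
  have := mul_le_mul_of_nonneg_left (cost_uniform_le hK hKN h0 hG) hθ.le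
  linarith

lemma le_mix {p : Fin N → ℝ} (hθ1 : θ ≤ 1) (hp : p ∈ feasible N K) (i : Fin N) :
    θ * (K / N) ≤ mix K θ p i := by
  have := mul_nonneg (sub_nonneg.2 hθ1) (hp.1 i).1.le
  simp only [mix]; linarith

lemma sq_div_mix_le (hK : 0 < K) (hKN : K ≤ N) (hθ : 0 < θ) (hθ1 : θ ≤ 1)
    (hγ : γ = G ^ 2 * (N / (K * θ))) {x : ℝ} {p : Fin N → ℝ} (h0 : 0 ≤ x) (hG : x ≤ G)
    (hp : p ∈ feasible N K) (i : Fin N) : x ^ 2 / mix K θ p i ≤ γ := by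
  have hN : (0 : ℝ) < N := hK.trans_le hKN
  calc x ^ 2 / mix K θ p i ≤ G ^ 2 / (θ * (K / N)) := by
        have := le_mix hθ1 hp i
        gcongr
    _ = γ := by rw [hγ]; field_simp

lemma estimate_nonneg {x q : Fin N → ℝ} (hq : ∀ i, 0 ≤ q i) (A : Finset (Fin N)) (i : Fin N) :
    0 ≤ estimate x q A i := by
  rw [estimate]
  split_ifs
  · exact div_nonneg (sq_nonneg _) (hq i)
  · rfl

lemma estimate_eq_mul_indicator {Ω : Type*} (x q : Fin N → ℝ) (S : Ω → ℕ → Finset (Fin N)) (t : ℕ) (ω : Ω)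
    (i : Fin N) : estimate x q (S ω t) i
      = x i ^ 2 / q i * {ω | i ∈ S ω t}.indicator (fun _ => (1 : ℝ)) ω := by
  by_cases h : i ∈ S ω t <;> simp [estimate, h]

/-- The regret of a run is at most a mean-zero term, a mixing term, a self-normalized deviation
term and a stability term. -/
lemma staticRegret_le (hK : 0 < K) (hKN : K ≤ N) (hθ : 0 < θ) (hθ1 : θ ≤ 1) (hγ0 : 0 < γ)
    (hγ : γ = G ^ 2 * (N / (K * θ))) {π p : ℕ → Fin N → ℝ} {S : ℕ → Finset (Fin N)}
    (h0 : ∀ t < T, ∀ i, 0 ≤ π t i) (hG : ∀ t < T, ∀ i, π t i ≤ G)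
    (hp : ∀ t < T, IsFTRL K γ
      (fun i => ∑ s ∈ Finset.range t, estimate (π s) (mix K θ (p s)) (S s) i) (p t)) :
    staticRegret K T π (fun t => mix K θ (p t))
      ≤ ∑ t ∈ Finset.range T, ∑ i,
          (π t i ^ 2 * ((1 - θ) / p t i)
            - estimate (π t) (mix K θ (p t)) (S t) i * ((1 - θ) / p t i))
        + ∑ i, (N / (θ * K) * (2 * γ
            + 2 * ((∑ t ∈ Finset.range T, estimate (π t) (mix K θ (p t)) (S t) i
              - ∑ t ∈ Finset.range T, π t i ^ 2) ^ 2 / (∑ t ∈ Finset.range T, π t i ^ 2 + γ)))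
          + N / K * (γ / θ
            + θ * (∑ t ∈ Finset.range T, estimate (π t) (mix K θ (p t)) (S t) i + γ)))
        + T * (θ * (G ^ 2 * N ^ 2 / K)) := by
  set x : ℕ → Fin N → ℝ := fun t i => estimate (π t) (mix K θ (p t)) (S t) i with hx
  have hmix : ∀ t < T, mix K θ (p t) ∈ feasible N K := fun t ht =>
    mix_mem_feasible hK hKN hθ hθ1 (hp t ht).1
  have hx0 : ∀ t < T, ∀ i, 0 ≤ x t i := fun t ht i =>
    estimate_nonneg (fun i => ((hmix t ht).1 i).1.le) _ i
  have hxγ : ∀ t < T, ∀ i, x t i ≤ γ := fun t ht i => by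
    simp only [hx, estimate]
    split_ifs
    · exact sq_div_mix_le hK hKN hθ hθ1 hγ (h0 t ht i) (hG t ht i) (hp t ht).1 i
    · exact hγ0.le
  have hV : ∀ i, 0 ≤ ∑ t ∈ Finset.range T, x t i := fun i =>
    Finset.sum_nonneg fun t ht => hx0 t (Finset.mem_range.1 ht) i
  have h1 : ∑ t ∈ Finset.range T, cost (π t) (mix K θ (p t))
      ≤ ∑ t ∈ Finset.range T, ∑ i, π t i ^ 2 * ((1 - θ) / p t i)
        + T * (θ * (G ^ 2 * N ^ 2 / K)) := by
    refine (Finset.sum_le_sum fun t ht => cost_mix_le hK hKN hθ hθ1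
      (h0 t (Finset.mem_range.1 ht)) (hG t (Finset.mem_range.1 ht))
      (hp t (Finset.mem_range.1 ht)).1).trans (le_of_eq ?_)
    rw [Finset.sum_add_distrib, Finset.sum_const, Finset.card_range, nsmul_eq_mul]
  have h2 : ∑ t ∈ Finset.range T, ∑ i, x t i * ((1 - θ) / p t i)
      - ∑ i, (N / (θ * K) * (2 * γ + 2 * ((∑ t ∈ Finset.range T, x t i
              - ∑ t ∈ Finset.range T, π t i ^ 2) ^ 2 / (∑ t ∈ Finset.range T, π t i ^ 2 + γ)))
          + N / K * (γ / θ + θ * (∑ t ∈ Finset.range T, x t i + γ)))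
      ≤ sInf ((fun q => ∑ t ∈ Finset.range T, cost (π t) q) '' feasible N K) := by
    refine le_csInf ⟨_, Set.mem_image_of_mem _ (uniform_mem_feasible hK hKN)⟩ ?_
    rintro _ ⟨q, hq, rfl⟩
    beta_reduce
    rw [sum_cost_eq]
    have a1 := leader_regret hK hγ0 hp hx0 hxγ (mix_mem_feasible hK hKN hθ hθ1 hq)
    have a2 := regularized_comparator hK hKN hθ hθ1 hγ0 hV
      (fun i => Finset.sum_nonneg fun t (_ : t ∈ Finset.range T) => sq_nonneg (π t i)) hq
    have a3 : (1 - θ) * (N / K * (√γ * ∑ i, √(∑ s ∈ Finset.range T, x s i + γ)))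
        ≤ N / K * ∑ i, (γ / θ + θ * (∑ t ∈ Finset.range T, x t i + γ)) := by
      have hle : √γ * ∑ i, √(∑ s ∈ Finset.range T, x s i + γ)
          ≤ ∑ i, (γ / θ + θ * (∑ t ∈ Finset.range T, x t i + γ)) := by
        rw [Finset.mul_sum]
        refine Finset.sum_le_sum fun i _ => ?_
        have hv : 0 ≤ ∑ s ∈ Finset.range T, x s i + γ := by linarith [hV i]
        set v := ∑ s ∈ Finset.range T, x s i + γ
        have e : (√γ - θ * √v) ^ 2 / θ = γ / θ + θ * v - 2 * (√γ * √v) := by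
          rw [sub_sq, mul_pow, Real.sq_sqrt hγ0.le, Real.sq_sqrt hv]
          field_simp; ring
        have : 0 ≤ (√γ - θ * √v) ^ 2 / θ := by positivity
        have : 0 ≤ √γ * √v := by positivity
        linarith
      have hpos : 0 ≤ N / K * (√γ * ∑ i, √(∑ s ∈ Finset.range T, x s i + γ)) := by positivity
      calc _ ≤ N / K * (√γ * ∑ i, √(∑ s ∈ Finset.range T, x s i + γ)) :=
            mul_le_of_le_one_left hpos (by linarith)
        _ ≤ _ := by gcongr
    have a4 : ∑ t ∈ Finset.range T, ∑ i, x t i * ((1 - θ) / p t i)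
        = (1 - θ) * ∑ t ∈ Finset.range T, ∑ i, x t i / p t i := by
      simp only [Finset.mul_sum]
      refine Finset.sum_congr rfl fun t _ => Finset.sum_congr rfl fun i _ => by ring
    have a5 := mul_le_mul_of_nonneg_left a1 (sub_nonneg.2 hθ1)
    rw [mul_add] at a5
    rw [Finset.sum_add_distrib, ← Finset.mul_sum, ← Finset.mul_sum, a4]
    linarith
  rw [staticRegret]
  simp only [Finset.sum_sub_distrib]
  linarith

lemma inv_leader_le (hK : 0 < K) (hKN : K ≤ N) (hγ0 : 0 < γ) {c p : Fin N → ℝ} {B : ℝ}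
    (hp : IsFTRL K γ c p) (hc : ∀ i, 0 ≤ c i) (hB : ∀ i, c i ≤ B * γ) (i : Fin N) :
    (p i)⁻¹ ≤ N * (B + 1) * (N / K) := by
  have hN : (0 : ℝ) < N := hK.trans_le hKN
  have h1 : γ * (p i)⁻¹ ≤ ∑ j, (c j + γ) / p j := by
    refine le_trans ?_ (Finset.single_le_sum (f := fun j => (c j + γ) / p j)
      (fun j _ => div_nonneg (by linarith [hc j]) (hp.1.1 j).1.le) (Finset.mem_univ i))
    rw [← div_eq_mul_inv]
    exact div_le_div_of_nonneg_right (by linarith [hc i]) (hp.1.1 i).1.le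
  have h2 := hp.2 _ (uniform_mem_feasible hK hKN)
  have h3 : ∑ i, (c i + γ) / (K / N) ≤ ∑ _i : Fin N, (B + 1) * γ / (K / N) := by
    refine Finset.sum_le_sum fun j _ => ?_
    have := hB j
    gcongr
    linarith
  have h4 : ∑ _i : Fin N, (B + 1) * γ / (K / N) = γ * (N * (B + 1) * (N / K)) := by
    rw [Finset.sum_const, Finset.card_univ, Fintype.card_fin, nsmul_eq_mul]
    field_simp
  exact le_of_mul_le_mul_left (by linarith) hγ0

/-- The value of the best fixed sampling probability is measurable in the cumulated feedback. -/
lemma measurable_iInf_cost : Measurable fun s : Fin N → ℝ =>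
    ⨅ q : feasible N K, ∑ i, |s i| / (q : Fin N → ℝ) i := by
  refine UpperSemicontinuous.measurable (upperSemicontinuous_ciInf (fun s => ⟨0, ?_⟩) fun q => ?_)
  · rintro _ ⟨q, rfl⟩
    exact Finset.sum_nonneg fun i _ => div_nonneg (abs_nonneg _) (q.2.1 i).1.le
  · refine Continuous.upperSemicontinuous ?_
    exact continuous_finsetSum _ fun i _ => ((continuous_apply i).abs).div_const _

end Pathwise

section Run

variable {Ω : Type*} {mΩ : MeasurableSpace Ω} {μ : Measure Ω} [IsProbabilityMeasure μ]
  {ℱ : Filtration ℕ mΩ} {N T : ℕ} {K G θ γ : ℝ} {π p : Ω → ℕ → Fin N → ℝ}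
  {S : Ω → ℕ → Finset (Fin N)}

lemma IsRun.mix_meas (h : IsRun μ ℱ K θ γ T π p S) {t : ℕ} (ht : t < T) (i : Fin N) :
    AEStronglyMeasurable[ℱ t] (fun ω => mix K θ (p ω t) i) μ :=
  stronglyMeasurable_condExp.aestronglyMeasurable.congr (h.condExp_inclusion ht i)

lemma IsRun.isObserved (h : IsRun μ ℱ K θ γ T π p S) (hK : 0 < K) (hKN : K ≤ N) (hθ : 0 < θ)
    (hθ1 : θ ≤ 1) (hγ : γ = G ^ 2 * (N / (K * θ)))
    (hπ : ∀ t < T, ∀ i, StronglyMeasurable[ℱ t] fun ω => π ω t i)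
    (hb : ∀ᵐ ω ∂μ, ∀ t < T, ∀ i, 0 ≤ π ω t i ∧ π ω t i ≤ G) (i : Fin N) :
    IsObserved μ ℱ T (G ^ 2) γ (fun t ω => π ω t i ^ 2) (fun t ω => mix K θ (p ω t) i)
      (fun t => {ω | i ∈ S ω t}.indicator fun _ => (1 : ℝ)) where
  f_meas t ht := ((hπ t ht i).pow 2).aestronglyMeasurable
  P_meas t ht := h.mix_meas ht i
  I_meas t ht := (h.inclusion_meas ht i).aestronglyMeasurable
  f_mem t ht := hb.mono fun ω hω =>
    ⟨sq_nonneg _, pow_le_pow_left₀ (hω t ht i).1 (hω t ht i).2 2⟩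
  P_pos t ht := ae_of_all _ fun ω =>
    (mix_mem_feasible hK hKN hθ hθ1 (h.ftrl t ht ω).1).1 i
  ratio_le t ht := hb.mono fun ω hω => sq_div_mix_le hK hKN hθ hθ1 hγ (hω t ht i).1 (hω t ht i).2
    (h.ftrl t ht ω).1 i
  I_mem t ω := by
    by_cases hi : i ∈ S ω t <;> simp [hi]
  condExp_eq t ht := h.condExp_inclusion ht i

lemma IsRun.inv_leader_meas (h : IsRun μ ℱ K θ γ T π p S) {t : ℕ} (ht : t < T) (i : Fin N) :
    AEStronglyMeasurable[ℱ t] (fun ω => (1 - θ) / p ω t i) μ := by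
  by_cases hθ : 1 - θ = 0
  · simpa [hθ] using aestronglyMeasurable_const
  · have e : (fun ω => (1 - θ) / p ω t i)
        = fun ω => (1 - θ) ^ 2 * (mix K θ (p ω t) i - θ * (K / N))⁻¹ := by
      ext ω
      simp only [mix, add_sub_cancel_right, mul_inv, ← mul_assoc, sq]
      field_simp
    rw [e]
    exact aestronglyMeasurable_const.mul ((h.mix_meas ht i).sub aestronglyMeasurable_const).inv₀

lemma IsRun.memLp_inv_leader (h : IsRun μ ℱ K θ γ T π p S) (hK : 0 < K) (hKN : K ≤ N)
    (hθ : 0 < θ) (hθ1 : θ ≤ 1) (hγ0 : 0 < γ) (hγ : γ = G ^ 2 * (N / (K * θ)))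
    (hb : ∀ᵐ ω ∂μ, ∀ t < T, ∀ i, 0 ≤ π ω t i ∧ π ω t i ≤ G) {t : ℕ} (ht : t < T) (i : Fin N) :
    MemLp (fun ω => (1 - θ) / p ω t i) ⊤ μ := by
  refine memLp_top_of_bound ((h.inv_leader_meas ht i).mono (ℱ.le t)) (N * (t + 1) * (N / K)) ?_
  filter_upwards [hb] with ω hω
  have hp := (h.ftrl t ht ω).1.1 i
  have h1 : (p ω t i)⁻¹ ≤ N * (t + 1) * (N / K) := by
    refine inv_leader_le hK hKN hγ0 (h.ftrl t ht ω) (fun j => ?_) (fun j => ?_) i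
    · exact Finset.sum_nonneg fun s hs => estimate_nonneg (fun k =>
        ((mix_mem_feasible hK hKN hθ hθ1
          (h.ftrl s ((Finset.mem_range.1 hs).trans ht) ω).1).1 k).1.le) _ j
    · refine (Finset.sum_le_card_nsmul _ _ γ fun s hs => ?_).trans (le_of_eq (by simp))
      have hs : s < T := (Finset.mem_range.1 hs).trans ht
      rw [estimate]
      split_ifs
      · exact sq_div_mix_le hK hKN hθ hθ1 hγ (hω s hs j).1 (hω s hs j).2 (h.ftrl s hs ω).1 j
      · exact hγ0.le
  rw [Real.norm_of_nonneg (div_nonneg (by linarith) hp.1.le), div_eq_mul_inv]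
  exact (mul_le_of_le_one_left (inv_nonneg.2 hp.1.le) (by linarith)).trans h1

lemma IsRun.integrable_staticRegret (h : IsRun μ ℱ K θ γ T π p S) (hK : 0 < K) (hKN : K ≤ N)
    (hθ : 0 < θ) (hθ1 : θ ≤ 1) (hγ : γ = G ^ 2 * (N / (K * θ)))
    (hπ : ∀ t < T, ∀ i, StronglyMeasurable[ℱ t] fun ω => π ω t i)
    (hb : ∀ᵐ ω ∂μ, ∀ t < T, ∀ i, 0 ≤ π ω t i ∧ π ω t i ≤ G) :
    Integrable (fun ω => staticRegret K T (π ω) fun t => mix K θ (p ω t)) μ := by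
  have hobs := h.isObserved hK hKN hθ hθ1 hγ hπ hb
  refine Integrable.sub ?_ ?_
  · refine integrable_finsetSum _ fun t ht => integrable_finsetSum _ fun i _ => ?_
    exact ((hobs i).memLp_ratio (Finset.mem_range.1 ht)).integrable le_top
  · have e : ∀ ω, sInf ((fun q => ∑ t ∈ Finset.range T, cost (π ω t) q) '' feasible N K)
        = ⨅ q : feasible N K, ∑ i, |∑ t ∈ Finset.range T, π ω t i ^ 2| / (q : Fin N → ℝ) i := by
      intro ω
      rw [sInf_image']
      refine iInf_congr fun q => ?_
      rw [sum_cost_eq]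
      refine Finset.sum_congr rfl fun i _ => ?_
      rw [abs_of_nonneg (Finset.sum_nonneg fun t _ => sq_nonneg _)]
    refine Integrable.of_bound ?_ (T * (G ^ 2 * N ^ 2 / K)) ?_
    · simp only [e]
      refine (measurable_iInf_cost.comp_aemeasurable
        (aemeasurable_pi_lambda _ fun i => ?_)).aestronglyMeasurable
      exact (((hobs i).sum_f_meas le_rfl (Nat.le_succ T)).mono (ℱ.le T)).aemeasurable
    · filter_upwards [hb] with ω hω
      have hnn : ∀ y ∈ (fun q => ∑ t ∈ Finset.range T, cost (π ω t) q) '' feasible N K, 0 ≤ y := by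
        rintro _ ⟨q, hq, rfl⟩
        exact Finset.sum_nonneg fun t _ => Finset.sum_nonneg fun i _ =>
          div_nonneg (sq_nonneg _) (hq.1 i).1.le
      rw [Real.norm_of_nonneg (Real.sInf_nonneg hnn)]
      refine (csInf_le ⟨0, hnn⟩ (Set.mem_image_of_mem _ (uniform_mem_feasible hK hKN))).trans ?_
      refine (Finset.sum_le_card_nsmul _ _ (G ^ 2 * N ^ 2 / K) fun t ht => ?_).trans
        (le_of_eq (by simp))
      exact cost_uniform_le hK hKN (fun i => (hω t (Finset.mem_range.1 ht) i).1)
        fun i => (hω t (Finset.mem_range.1 ht) i).2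

lemma IsRun.integral_staticRegret_le (h : IsRun μ ℱ K θ γ T π p S) (hK : 0 < K) (hKN : K ≤ N)
    (hθ : 0 < θ) (hθ1 : θ ≤ 1) (hγ0 : 0 < γ) (hγ : γ = G ^ 2 * (N / (K * θ))) (hGγ : G ^ 2 ≤ γ)
    (hπ : ∀ t < T, ∀ i, StronglyMeasurable[ℱ t] fun ω => π ω t i)
    (hb : ∀ᵐ ω ∂μ, ∀ t < T, ∀ i, 0 ≤ π ω t i ∧ π ω t i ≤ G) :
    ∫ ω, staticRegret K T (π ω) (fun t => mix K θ (p ω t)) ∂μ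
      ≤ N * (N / (θ * K) * (2 * γ + 2 * (γ * Real.log (T + 1)))
          + N / K * (γ / θ + θ * (T * G ^ 2 + γ))) + T * (θ * (G ^ 2 * N ^ 2 / K)) := by
  have hN : (0 : ℝ) < N := hK.trans_le hKN
  have hobs := h.isObserved hK hKN hθ hθ1 hγ hπ hb
  set x : ℕ → Fin N → Ω → ℝ := fun t i ω => π ω t i ^ 2 / mix K θ (p ω t) i
    * {ω | i ∈ S ω t}.indicator (fun _ => (1 : ℝ)) ω with hx
  set r : ℕ → Fin N → Ω → ℝ := fun t i ω => (1 - θ) / p ω t i with hr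
  have hrb : ∀ t < T, ∀ i, MemLp (r t i) ⊤ μ := fun t ht i =>
    h.memLp_inv_leader hK hKN hθ hθ1 hγ0 hγ hb ht i
  have hfr : ∀ t < T, ∀ i, Integrable (fun ω => π ω t i ^ 2 * r t i ω) μ := fun t ht i =>
    ((hrb t ht i).mul (r := ⊤) ((hobs i).memLp_f ht)).integrable le_top
  have hxr : ∀ t < T, ∀ i, Integrable (fun ω => x t i ω * r t i ω) μ := fun t ht i =>
    ((hrb t ht i).mul (r := ⊤) ((hobs i).memLp_estimate ht)).integrable le_top
  have hfxr : ∀ t < T, ∀ i, Integrable (fun ω => π ω t i ^ 2 * r t i ω - x t i ω * r t i ω) μ :=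
    fun t ht i => (hfr t ht i).sub (hxr t ht i)
  set D : Fin N → Ω → ℝ := fun i ω => (∑ t ∈ Finset.range T, x t i ω
    - ∑ t ∈ Finset.range T, π ω t i ^ 2) ^ 2 / (∑ t ∈ Finset.range T, π ω t i ^ 2 + γ) with hD
  have hDi : ∀ i, Integrable (D i) μ := fun i =>
    ((hobs i).memLp_deviation hγ0 le_rfl).integrable le_top
  have hxi : ∀ t < T, ∀ i, Integrable (x t i) μ := fun t ht i =>
    ((hobs i).memLp_estimate ht).integrable le_top
  have hVi : ∀ i, Integrable (fun ω => ∑ t ∈ Finset.range T, x t i ω) μ := fun i =>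
    ((hobs i).memLp_sum_estimate le_rfl).integrable le_top
  have hH2 : ∀ i, Integrable (fun ω => N / (θ * K) * (2 * γ + 2 * D i ω)) μ := fun i =>
    ((integrable_const _).add ((hDi i).const_mul 2)).const_mul _
  have hH3 : ∀ i, Integrable (fun ω => N / K * (γ / θ
      + θ * (∑ t ∈ Finset.range T, x t i ω + γ))) μ := fun i =>
    ((integrable_const _).add (((hVi i).add (integrable_const _)).const_mul θ)).const_mul _
  have hH : ∀ i, Integrable (fun ω => N / (θ * K) * (2 * γ + 2 * D i ω)
      + N / K * (γ / θ + θ * (∑ t ∈ Finset.range T, x t i ω + γ))) μ := fun i =>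
    (hH2 i).add (hH3 i)
  have hbound : ∀ᵐ ω ∂μ, staticRegret K T (π ω) (fun t => mix K θ (p ω t))
      ≤ (∑ t ∈ Finset.range T, ∑ i, (π ω t i ^ 2 * r t i ω - x t i ω * r t i ω)
        + ∑ i, (N / (θ * K) * (2 * γ + 2 * D i ω)
          + N / K * (γ / θ + θ * (∑ t ∈ Finset.range T, x t i ω + γ))))
        + T * (θ * (G ^ 2 * N ^ 2 / K)) := by
    filter_upwards [hb] with ω hω
    have := staticRegret_le (S := S ω) hK hKN hθ hθ1 hγ0 hγ (fun t ht i => (hω t ht i).1)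
      (fun t ht i => (hω t ht i).2) (fun t ht => h.ftrl t ht ω)
    simpa only [estimate_eq_mul_indicator] using this
  have hI1 : Integrable (fun ω => ∑ t ∈ Finset.range T, ∑ i,
      (π ω t i ^ 2 * r t i ω - x t i ω * r t i ω)) μ :=
    integrable_finsetSum _ fun t ht => integrable_finsetSum _ fun i _ =>
      hfxr t (Finset.mem_range.1 ht) i
  have hI2 : Integrable (fun ω => ∑ i, (N / (θ * K) * (2 * γ + 2 * D i ω)
          + N / K * (γ / θ + θ * (∑ t ∈ Finset.range T, x t i ω + γ)))) μ :=
    integrable_finsetSum _ fun i _ => hH i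
  refine (integral_mono_ae (h.integrable_staticRegret hK hKN hθ hθ1 hγ hπ hb)
    ((hI1.add hI2).add (integrable_const _)) hbound).trans ?_
  have e0 : ∫ ω, ∑ t ∈ Finset.range T, ∑ i, (π ω t i ^ 2 * r t i ω - x t i ω * r t i ω) ∂μ = 0 := by
    rw [integral_finsetSum _ fun t ht => integrable_finsetSum _ fun i _ =>
      hfxr t (Finset.mem_range.1 ht) i]
    refine Finset.sum_eq_zero fun t ht => ?_
    have ht := Finset.mem_range.1 ht
    rw [integral_finsetSum _ fun i _ => hfxr t ht i]
    refine Finset.sum_eq_zero fun i _ => ?_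
    rw [integral_sub (hfr t ht i) (hxr t ht i), sub_eq_zero]
    exact ((hobs i).integral_estimate_mul ht (h.inv_leader_meas ht i) (hrb t ht i)).symm
  have eD : ∀ i, ∫ ω, D i ω ∂μ ≤ γ * Real.log (T + 1) := by
    intro i
    refine ((hobs i).integral_deviation_le hγ0 le_rfl).trans ?_
    have hlog : ∫ ω, Real.log (∑ t ∈ Finset.range T, π ω t i ^ 2 + γ) ∂μ
        ≤ Real.log (T + 1) + Real.log γ := by
      have := integral_mono_ae ((hobs i).integrable_log hγ0 le_rfl)
        (integrable_const (μ := μ) (Real.log (T + 1) + Real.log γ)) ?_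
      · simpa using this
      · filter_upwards [(hobs i).sum_nonneg le_rfl, (hobs i).sum_le le_rfl] with ω h1 h2
        rw [← Real.log_mul (by positivity) hγ0.ne']
        refine Real.log_le_log (by linarith) ?_
        have := mul_le_mul_of_nonneg_left hGγ (Nat.cast_nonneg (α := ℝ) T)
        linarith
    have := mul_le_mul_of_nonneg_left hlog hγ0.le
    linarith
  have eV : ∀ i, ∫ ω, ∑ t ∈ Finset.range T, x t i ω ∂μ ≤ T * G ^ 2 := by
    intro i
    rw [integral_finsetSum _ fun t ht => hxi t (Finset.mem_range.1 ht) i]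
    refine (Finset.sum_le_card_nsmul _ _ (G ^ 2) fun t ht => ?_).trans (le_of_eq (by simp))
    have ht := Finset.mem_range.1 ht
    rw [(hobs i).integral_estimate ht]
    have := integral_mono_ae (((hobs i).memLp_f ht).integrable le_top)
      (integrable_const (μ := μ) (G ^ 2)) (((hobs i).f_mem t ht).mono fun ω hω => hω.2)
    simpa using this
  have e2 : ∫ ω, ∑ i, (N / (θ * K) * (2 * γ + 2 * D i ω)
          + N / K * (γ / θ + θ * (∑ t ∈ Finset.range T, x t i ω + γ))) ∂μ
      ≤ N * (N / (θ * K) * (2 * γ + 2 * (γ * Real.log (T + 1)))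
          + N / K * (γ / θ + θ * (T * G ^ 2 + γ))) := by
    rw [integral_finsetSum _ fun i _ => hH i]
    refine (Finset.sum_le_card_nsmul _ _ _ fun i _ => ?_).trans (le_of_eq (by
      rw [Finset.card_univ, Fintype.card_fin, nsmul_eq_mul]))
    have hVγ : Integrable (fun ω => ∑ t ∈ Finset.range T, x t i ω + γ) μ :=
      (hVi i).add (integrable_const _)
    rw [integral_add (hH2 i) (hH3 i), integral_const_mul, integral_const_mul,
      integral_add (integrable_const _) ((hDi i).const_mul 2), integral_const_mul 2 (D i),
      integral_add (integrable_const _) (hVγ.const_mul θ),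
      integral_const_mul θ, integral_add (hVi i) (integrable_const _)]
    simp only [integral_const, probReal_univ, one_smul]
    gcongr
    · exact eD i
    · exact eV i
  calc _ = (∫ ω, ∑ t ∈ Finset.range T, ∑ i, (π ω t i ^ 2 * r t i ω - x t i ω * r t i ω) ∂μ
        + ∫ ω, ∑ i, (N / (θ * K) * (2 * γ + 2 * D i ω)
          + N / K * (γ / θ + θ * (∑ t ∈ Finset.range T, x t i ω + γ))) ∂μ)
        + T * (θ * (G ^ 2 * N ^ 2 / K)) := by
        rw [← integral_add hI1 hI2]
        refine (integral_add (hI1.add hI2) (integrable_const _)).trans ?_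
        simp
    _ ≤ _ := by rw [e0, zero_add]; gcongr

end Run

/-- Tuning of the mixing and regularization parameters. -/
lemma tuned_bound_le {N T : ℕ} {K G θ γ : ℝ} (hK : 0 < K) (hN : (0 : ℝ) < N) (hT : 1 ≤ T)
    (hθ : 0 < θ) (hθ1 : θ ≤ 1) (hθ3 : θ ^ 3 * (T * K) = N) (hγ : γ = G ^ 2 * (N / (K * θ))) :
    N * (N / (θ * K) * (2 * γ + 2 * (γ * Real.log (T + 1)))
          + N / K * (γ / θ + θ * (T * G ^ 2 + γ))) + T * (θ * (G ^ 2 * N ^ 2 / K))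
      ≤ 8 * (1 + Real.log T) * (G ^ 2 * N ^ 2 * (T * θ / K)) := by
  have hT0 : (1 : ℝ) ≤ T := by exact_mod_cast hT
  have hγθ : γ = G ^ 2 * T * θ ^ 2 := by
    rw [hγ, ← hθ3]; field_simp
  have hlog : Real.log (T + 1) ≤ 1 + Real.log T := by
    have h1 : Real.log (T + 1) ≤ Real.log (2 * T) :=
      Real.log_le_log (by linarith) (by linarith)
    rw [Real.log_mul (by norm_num) (by linarith)] at h1
    linarith [Real.log_two_lt_d9]
  have hlogT : 0 ≤ Real.log T := Real.log_nonneg hT0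
  have e : N * (N / (θ * K) * (2 * γ + 2 * (γ * Real.log (T + 1)))
          + N / K * (γ / θ + θ * (T * G ^ 2 + γ))) + T * (θ * (G ^ 2 * N ^ 2 / K))
      = (5 + θ ^ 2 + 2 * Real.log (T + 1)) * (G ^ 2 * N ^ 2 * (T * θ / K)) := by
    rw [hγθ]; field_simp; ring
  rw [e]
  have : θ ^ 2 ≤ 1 := pow_le_one₀ hθ.le hθ1
  gcongr
  linarith

lemma horizon_mul_rate {N T K : ℝ} (hN : 0 < N) (hT : 0 < T) (hK : 0 < K) :
    T * (N / (T * K)) ^ ((1 : ℝ) / 3) / K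
      = N ^ ((1 : ℝ) / 3) * T ^ ((2 : ℝ) / 3) / K ^ ((4 : ℝ) / 3) := by
  rw [Real.div_rpow hN.le (by positivity), Real.mul_rpow hT.le hK.le]
  have h1 : T = T ^ ((2 : ℝ) / 3) * T ^ ((1 : ℝ) / 3) := by
    rw [← Real.rpow_add hT]; norm_num
  have h2 : K ^ ((4 : ℝ) / 3) = K * K ^ ((1 : ℝ) / 3) := by
    rw [← Real.rpow_one_add' hK.le (by norm_num)]; norm_num
  rw [h2]
  have : 0 < T ^ ((1 : ℝ) / 3) := by positivity
  have : 0 < K ^ ((1 : ℝ) / 3) := by positivity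
  nth_rewrite 1 [h1]
  field_simp

end KVib

theorem mainTheorem1 :
    ∃ (C : ℝ) (k : ℕ), 0 < C ∧
      ∀ (N d T : ℕ) (K G θ γ : ℝ), 1 ≤ K → K ≤ N → (N : ℝ) ≤ T * K → 0 < G →
        θ = ((N : ℝ) / (T * K)) ^ ((1 : ℝ) / 3) → γ = G ^ 2 * (N / (K * θ)) →
      ∀ (Ω : Type*) (mΩ : MeasurableSpace Ω) (μ : Measure Ω) (_ : IsProbabilityMeasure μ)
        (ℱ : Filtration ℕ mΩ) (lam : Fin N → ℝ)
        (g : Ω → ℕ → Fin N → EuclideanSpace ℝ (Fin d))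
        (p : Ω → ℕ → Fin N → ℝ) (S : Ω → ℕ → Finset (Fin N)),
        (∀ i, 0 ≤ lam i) → ∑ i, lam i = 1 →
        (∀ t < T, ∀ i, StronglyMeasurable[ℱ t] (fun ω => g ω t i)) →
        (∀ᵐ ω ∂μ, KVib.ConvergentFeedback (KVib.feedback lam (g ω))) →
        (∀ᵐ ω ∂μ, ∀ t < T, ∀ i, KVib.feedback lam (g ω) t i ≤ G) →
        KVib.IsRun μ ℱ K θ γ T (fun ω => KVib.feedback lam (g ω)) p S →
        Integrable (fun ω => KVib.staticRegret K T (KVib.feedback lam (g ω))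
          (fun t => KVib.mix K θ (p ω t))) μ ∧
        (1 / (N : ℝ) ^ 2) * ∫ ω, KVib.staticRegret K T (KVib.feedback lam (g ω))
            (fun t => KVib.mix K θ (p ω t)) ∂μ
          ≤ C * G ^ 2 * (1 + Real.log T) ^ k *
              ((N : ℝ) ^ ((1 : ℝ) / 3) * (T : ℝ) ^ ((2 : ℝ) / 3) / K ^ ((4 : ℝ) / 3)) := by
  refine ⟨8, 1, by norm_num, ?_⟩
  intro N d T K G θ γ hK1 hKN hTK hG hθ hγ Ω mΩ μ hμ ℱ lam g p S hlam _ hg _ hbd hrun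
  have hK : 0 < K := by linarith
  have hN : (0 : ℝ) < N := by linarith
  have hT : 0 < T := by
    rcases Nat.eq_zero_or_pos T with rfl | h
    · rw [Nat.cast_zero, zero_mul] at hTK; linarith
    · exact h
  have hT0 : (0 : ℝ) < T := by exact_mod_cast hT
  have hfrac : 0 < (N : ℝ) / (T * K) := by positivity
  have hθ0 : 0 < θ := by rw [hθ]; positivity
  have hθ1 : θ ≤ 1 := by
    rw [hθ]
    exact Real.rpow_le_one hfrac.le ((div_le_one (by positivity)).2 hTK) (by norm_num)
  have hθ3 : θ ^ 3 * (T * K) = N := by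
    rw [hθ, ← Real.rpow_natCast, ← Real.rpow_mul hfrac.le]
    norm_num
    field_simp
  have hγ0 : 0 < γ := by rw [hγ]; positivity
  have hGγ : G ^ 2 ≤ γ := by
    rw [hγ]
    refine le_mul_of_one_le_right (sq_nonneg G) ((one_le_div (by positivity)).2 ?_)
    exact (mul_le_of_le_one_right hK.le hθ1).trans hKN
  have hπ : ∀ t < T, ∀ i, StronglyMeasurable[ℱ t] fun ω => KVib.feedback lam (g ω) t i :=
    fun t ht i => (hg t ht i).norm.const_mul (lam i)
  have hb : ∀ᵐ ω ∂μ, ∀ t < T, ∀ i,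
      0 ≤ KVib.feedback lam (g ω) t i ∧ KVib.feedback lam (g ω) t i ≤ G :=
    hbd.mono fun ω hω t ht i => ⟨mul_nonneg (hlam i) (norm_nonneg _), hω t ht i⟩
  refine ⟨hrun.integrable_staticRegret hK hKN hθ0 hθ1 hγ hπ hb, ?_⟩
  have h1 := hrun.integral_staticRegret_le hK hKN hθ0 hθ1 hγ0 hγ hGγ hπ hb
  have h2 := KVib.tuned_bound_le hK hN hT hθ0 hθ1 hθ3 hγ
  rw [← KVib.horizon_mul_rate hN hT0 hK, ← hθ, pow_one]
  calc _ ≤ 1 / (N : ℝ) ^ 2 * (8 * (1 + Real.log T) * (G ^ 2 * N ^ 2 * (T * θ / K))) := by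
        gcongr
        exact h1.trans h2
    _ = _ := by field_simp
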